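/- Let $P\subset\mathbb R^d$ be a polytope (the convex hull of a nonempty finite set). For $Q\in\mathbb R^{d\times n}$ and $\mu\in\mathbb R^d$ let $Z(Q,\mu)=\{Qx+\mu : x\in[0,1]^n\}$ be the zonotope with generators the columns of $Q$ and translation vector $\mu$; for $q\in Z(Q,\mu)$ let $\mathrm{Lift}(q)=\{x\in[0,1]^n : Qx+\mu=q\}$. Write $d_P(Z)$ for the Hausdorff distance between $P$ and $Z$ with respect to the Euclidean metric, and $\Pi(x,K)$ for the point of a polytope $K$ nearest to $x$. A point $x$ is *Hausdorff stable* relative to a polytope $K$ if $x$ lies in the interior of $K$, or $x-\Pi(x,K)$ lies in the relative interior of the normal cone $\{v : \langle v,z-\Pi(x,K)\rangle\le 0\ \ \forall z\in K\}$ of $K$ at $\Pi(x,K)$. Fix $Z=Z(Q,\mu)\neq P$ such that the following *locality conditions* hold: (1) the generators of $Z$ are in general position (any at most $d$ of them are linearly independent); (2) every vertex of $P$ is Hausdorff stable relative to $Z$, and every vertex of $Z$ is Hausdorff stable relative to $P$. Say that a pair $(p,q)\in P\times Z$ *achieves* $d_P(Z)$ if $\|p-q\|_2=d_P(Z)$ and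 either $p$ is a vertex of $P$ and $q=\Pi(p,Z)$, or $q$ is a vertex of $Z$ and $p=\Pi(q,P)$. Then $d_P(Z)$ is achieved at finitely many pairs $(p_1,q_1),\dots,(p_k,q_k)$, $k\ge 1$; each $q_i$ has a unique lift $e_i$, that is, $\mathrm{Lift}(q_i)=\{e_i\}$; and the feasibility cone $$\mathcal C(P,Z)=\{(\Delta Q,\Delta\mu)\in\mathbb R^{d\times n}\times\mathbb R^d : \langle \Delta Q\,e_i+\Delta\mu,\;p_i-q_i\rangle\ge 0 \text{ for all } i\}$$ is a polyhedral cone (the solution set of finitely many homogeneous linear inequalities). Moreover, for every $(\Delta Q,\Delta\mu)$ in the interior of $\mathcal C(P,Z)$ there exists $\varepsilon>0$ such that for all $t$ with $0<t<\varepsilon$ the perturbed zonotope $Z_t=Z(Q+t\,\Delta Q,\mu+t\,\Delta\mu)$ satisfies $d_P(Z_t)<d_P(Z)$. -/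

import Mathlib

/-- The affine map `x ↦ Q x + μ` from `ℝⁿ` to Euclidean `ℝᵈ`. -/
noncomputable def zonotopeMap {d n : ℕ} (Q : Matrix (Fin d) (Fin n) ℝ)
    (μ : EuclideanSpace ℝ (Fin d)) (x : Fin n → ℝ) : EuclideanSpace ℝ (Fin d) :=
  WithLp.toLp 2 (Q.mulVec x) + μ

/-- The zonotope `Z(Q, μ)`: the image of the unit cube `[0,1]ⁿ` under `x ↦ Q x + μ`.
The generators are the columns of `Q`. -/
def zonotope {d n : ℕ} (Q : Matrix (Fin d) (Fin n) ℝ)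
    (μ : EuclideanSpace ℝ (Fin d)) : Set (EuclideanSpace ℝ (Fin d)) :=
  zonotopeMap Q μ '' Set.Icc 0 1

/-- `Lift(q)`: the set of points of the unit cube that are mapped to `q`. -/
def zonotopeLift {d n : ℕ} (Q : Matrix (Fin d) (Fin n) ℝ)
    (μ : EuclideanSpace ℝ (Fin d)) (q : EuclideanSpace ℝ (Fin d)) : Set (Fin n → ℝ) :=
  {x | x ∈ Set.Icc 0 1 ∧ zonotopeMap Q μ x = q}

/-- The generators (columns of `Q`) are in general position: any at most `d` of them are
linearly independent. -/
def InGeneralPosition {d n : ℕ} (Q : Matrix (Fin d) (Fin n) ℝ) : Prop :=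
  ∀ s : Finset (Fin n), s.card ≤ d → LinearIndependent ℝ (fun i : s => Q.col i)

section Convexity

variable {E : Type*} [NormedAddCommGroup E] [InnerProductSpace ℝ E]

/-- A polytope: the convex hull of a nonempty finite set. -/
def IsPolytope (P : Set E) : Prop :=
  ∃ s : Finset E, s.Nonempty ∧ P = convexHull ℝ (s : Set E)

/-- `y` is a point of `K` nearest to `x`, that is, `y` is the projection `Π(x, K)` when `K` is
nonempty, closed and convex in a Euclidean space. -/
def IsNearestPoint (K : Set E) (x y : E) : Prop :=
  y ∈ K ∧ dist x y = Metric.infDist x K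

/-- The (outer) normal cone to `K` at `y`. -/
def outerNormalCone (K : Set E) (y : E) : Set E :=
  {v | ∀ z ∈ K, inner ℝ v (z - y) ≤ 0}

/-- `x` is Hausdorff stable relative to `K`: either `x` is an interior point of `K`, or `x` lies
in the relative interior of the normal cone attached to `K` at the projection of `x`. -/
def IsHausdorffStable (K : Set E) (x : E) : Prop :=
  x ∈ interior K ∨
    ∃ y, IsNearestPoint K x y ∧ x - y ∈ intrinsicInterior ℝ (outerNormalCone K y)

/-- The pair `(p, q)` achieves the Hausdorff distance of the polytopes `P` and `Z`:
`‖p - q‖` is the Hausdorff distance, and one of the two points is a vertex of its polytope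
while the other one is the projection of that vertex to the other polytope. -/
def AchievesHausdorffDist (P Z : Set E) (p q : E) : Prop :=
  dist p q = Metric.hausdorffDist P Z ∧
    ((p ∈ P.extremePoints ℝ ∧ IsNearestPoint Z p q) ∨
      (q ∈ Z.extremePoints ℝ ∧ IsNearestPoint P q p))

end Convexity

/-- A polyhedral cone: the solution set of finitely many homogeneous linear inequalities. -/
def IsPolyhedralCone {V : Type*} [AddCommGroup V] [Module ℝ V] (C : Set V) : Prop :=
  ∃ K : PointedCone ℝ V,
    K.DualFG (LinearMap.id : Module.Dual ℝ V →ₗ[ℝ] Module.Dual ℝ V) ∧ (K : Set V) = C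

/-- The locality conditions on a polytope `P` and the zonotope `Z(Q, μ)`. -/
structure LocalityConditions {d n : ℕ} (P : Set (EuclideanSpace ℝ (Fin d)))
    (Q : Matrix (Fin d) (Fin n) ℝ) (μ : EuclideanSpace ℝ (Fin d)) : Prop where
  generalPosition : InGeneralPosition Q
  stable_vertices_left : ∀ p ∈ P.extremePoints ℝ, IsHausdorffStable (zonotope Q μ) p
  stable_vertices_right : ∀ q ∈ (zonotope Q μ).extremePoints ℝ, IsHausdorffStable P q

/-- The feasibility cone: all `(ΔQ, Δμ)` with `⟨ΔQ e + Δμ, p - q⟩ ≥ 0` for every pair `(p, q)`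
achieving the Hausdorff distance of `P` and `Z(Q, μ)`, with `e` the lift of `q`. -/
def feasibilityCone {d n : ℕ} (P : Set (EuclideanSpace ℝ (Fin d)))
    (Q : Matrix (Fin d) (Fin n) ℝ) (μ : EuclideanSpace ℝ (Fin d)) :
    Set (Matrix (Fin d) (Fin n) ℝ × EuclideanSpace ℝ (Fin d)) :=
  {Δ | ∀ p q, AchievesHausdorffDist P (zonotope Q μ) p q →
    ∀ e ∈ zonotopeLift Q μ q, 0 ≤ inner ℝ (zonotopeMap Δ.1 Δ.2 e) (p - q)}

open Filter Topology Metric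

/-! The Hausdorff distance of two polytopes is below `δ` as soon as each of finitely many generating
points is within less than `δ` of the other polytope (`hausdorffDist_convexHull_lt`). Generating `P`
by its vertices and `Z_t` by the images of the cube vertices leaves finitely many strict
inequalities. Those strict at `t = 0` persist by continuity. The others come from achieving pairs
`(p, q)`: with `e` the lift of `q`, the point `q` moves to `q + t (ΔQ e + Δμ)`, and in the interior
of the cone this velocity makes an acute angle with `p - q`, so the distance drops. Lifts are unique
because `p - q` or its opposite is a nonzero normal of `Z` at `q`: two lifts differ only along
generators orthogonal to it, which general position makes independent (`zonotopeLift_unique`). -/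

theorem exists_infDist_le_of_forall_lt {X : Type*} [PseudoMetricSpace X] {K : Set X}
    (hK : IsCompact K) {δ : ℝ} (hδ : 0 < δ) {B : Set X} (h : ∀ x ∈ K, infDist x B < δ) :
    ∃ r, 0 ≤ r ∧ r < δ ∧ ∀ x ∈ K, infDist x B ≤ r := by
  rcases K.eq_empty_or_nonempty with rfl | hne
  · exact ⟨0, le_rfl, hδ, by simp⟩
  · obtain ⟨x, hx, hmax⟩ := hK.exists_isMaxOn hne (continuous_infDist_pt B).continuousOn
    exact ⟨infDist x B, infDist_nonneg, h x hx, fun y hy => hmax hy⟩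

theorem IsCompact.exists_isNearestPoint {E : Type*} [NormedAddCommGroup E] {K : Set E}
    (hK : IsCompact K) (hne : K.Nonempty) (x : E) :
    ∃ y, IsNearestPoint K x y := by
  obtain ⟨y, hy, h⟩ := hK.exists_infDist_eq_dist hne x
  exact ⟨y, hy, h.symm⟩

/-! ### Nearest points, polytopes and pairs achieving the Hausdorff distance -/

section Convexity

variable {E : Type*} [NormedAddCommGroup E] [InnerProductSpace ℝ E]

/-- The vector from the nearest point of a convex set is an outer normal. -/
theorem IsNearestPoint.inner_sub_le_zero {K : Set E} (hK : Convex ℝ K) {x y : E}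
    (h : IsNearestPoint K x y) : ∀ z ∈ K, inner ℝ (x - y) (z - y) ≤ 0 := by
  refine (norm_eq_iInf_iff_real_inner_le_zero hK h.1).1 ?_
  rw [← dist_eq_norm, h.2, infDist_eq_iInf]
  simp only [dist_eq_norm]

theorem IsNearestPoint.unique {K : Set E} (hK : Convex ℝ K) {x y z : E}
    (hy : IsNearestPoint K x y) (hz : IsNearestPoint K x z) : y = z := by
  have h1 := hy.inner_sub_le_zero hK z hz.1
  have h2 := hz.inner_sub_le_zero hK y hy.1
  have h3 : inner ℝ (z - y) (z - y) ≤ 0 := by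
    have : inner ℝ (z - y) (z - y) = inner ℝ (x - y) (z - y) + inner ℝ (x - z) (y - z) := by
      simp only [inner_sub_left, inner_sub_right, real_inner_comm]
      ring
    linarith
  exact (sub_eq_zero.1 (inner_self_eq_zero.1 (h3.antisymm real_inner_self_nonneg))).symm

/-- At a point `q` of `Z` that is farthest from a compact convex set `P`, the vector to `q` from its
nearest point in `P` is an outer normal of `Z`. -/
theorem IsNearestPoint.inner_sub_le_zero_of_farthest {P Z : Set E} (hPc : IsCompact P)
    (hP : Convex ℝ P) {p q : E} (h : IsNearestPoint P q p)
    (hfar : ∀ z ∈ Z, infDist z P ≤ dist q p) : ∀ z ∈ Z, inner ℝ (q - p) (z - q) ≤ 0 := by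
  intro z hz
  obtain ⟨y, hy, hzy⟩ := hPc.exists_isNearestPoint ⟨p, h.1⟩ z
  have h1 : ‖z - y‖ ≤ ‖q - p‖ := by
    rw [← dist_eq_norm, ← dist_eq_norm, hzy]
    exact hfar z hz
  have h2 := h.inner_sub_le_zero hP y hy
  have h3 := real_inner_le_norm (q - p) (z - y)
  -- The first term is at most `‖q - p‖ ^ 2` by Cauchy–Schwarz and `h1`, the second is nonpositive
  -- by `h2`.
  have h4 : inner ℝ (q - p) (z - q) =
      inner ℝ (q - p) (z - y) + inner ℝ (q - p) (y - p) - inner ℝ (q - p) (q - p) := by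
    rw [← inner_add_right, ← inner_sub_right]
    congr 1
    abel
  rw [h4, real_inner_self_eq_norm_mul_norm]
  nlinarith [mul_le_mul_of_nonneg_left h1 (norm_nonneg (q - p))]

/-- The Hausdorff distance of two polytopes is controlled by their vertices. -/
theorem hausdorffDist_convexHull_lt {s t : Set E} (hs : s.Finite) (ht : t.Finite)
    (hsne : s.Nonempty) (htne : t.Nonempty) {δ : ℝ} (hδ : 0 < δ)
    (hst : ∀ x ∈ s, infDist x (convexHull ℝ t) < δ)
    (hts : ∀ x ∈ t, infDist x (convexHull ℝ s) < δ) :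
    hausdorffDist (convexHull ℝ s) (convexHull ℝ t) < δ := by
  have key : ∀ a b : Set E, b.Nonempty → (∀ x ∈ a, infDist x (convexHull ℝ b) < δ) →
      ∀ x ∈ convexHull ℝ a, infDist x (convexHull ℝ b) < δ := by
    intro a b hb h x hx
    rw [← mem_thickening_iff_infDist_lt hb.convexHull]
    -- An open thickening of a convex set is convex, so it contains the hull of `a` once it contains
    -- `a`.
    refine convexHull_min (fun y hy => ?_) ((convex_convexHull ℝ b).thickening δ) hx
    exact (mem_thickening_iff_infDist_lt hb.convexHull).2 (h y hy)
  -- Pointwise strict bounds give only `≤ δ` for the supremum; compactness supplies a uniform bound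
  -- below `δ`.
  obtain ⟨r, hr, hrδ, hr'⟩ :=
    exists_infDist_le_of_forall_lt (hs.isCompact_convexHull ℝ) hδ (key s t htne hst)
  obtain ⟨r₁, -, hrδ₁, hr₁'⟩ :=
    exists_infDist_le_of_forall_lt (ht.isCompact_convexHull ℝ) hδ (key t s hsne hts)
  refine (hausdorffDist_le_of_infDist (hr.trans (le_max_left r r₁)) ?_ ?_).trans_lt
    (max_lt hrδ hrδ₁)
  · exact fun x hx => (hr' x hx).trans (le_max_left _ _)
  · exact fun x hx => (hr₁' x hx).trans (le_max_right _ _)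

theorem IsPolytope.isCompact {K : Set E} (hK : IsPolytope K) : IsCompact K := by
  obtain ⟨s, -, rfl⟩ := hK
  exact s.finite_toSet.isCompact_convexHull ℝ

theorem IsPolytope.convex {K : Set E} (hK : IsPolytope K) : Convex ℝ K := by
  obtain ⟨s, -, rfl⟩ := hK
  exact convex_convexHull ℝ _

theorem IsPolytope.nonempty {K : Set E} (hK : IsPolytope K) : K.Nonempty := by
  obtain ⟨s, hs, rfl⟩ := hK
  exact (Finset.coe_nonempty.2 hs).convexHull

theorem IsPolytope.finite_extremePoints {K : Set E} (hK : IsPolytope K) :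
    (K.extremePoints ℝ).Finite := by
  obtain ⟨s, -, rfl⟩ := hK
  exact s.finite_toSet.subset extremePoints_convexHull_subset

theorem IsPolytope.convexHull_extremePoints {K : Set E} (hK : IsPolytope K) :
    convexHull ℝ (K.extremePoints ℝ) = K := by
  conv_rhs => rw [← closure_convexHull_extremePoints hK.isCompact hK.convex]
  exact (hK.finite_extremePoints.isClosed_convexHull ℝ).closure_eq.symm

theorem IsPolytope.extremePoints_nonempty {K : Set E} (hK : IsPolytope K) :
    (K.extremePoints ℝ).Nonempty :=
  hK.isCompact.extremePoints_nonempty hK.nonempty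

theorem IsPolytope.hausdorffEDist_ne_top {P Z : Set E} (hP : IsPolytope P) (hZ : IsPolytope Z) :
    hausdorffEDist P Z ≠ ⊤ :=
  hausdorffEDist_ne_top_of_nonempty_of_bounded hP.nonempty hZ.nonempty
    hP.isCompact.isBounded hZ.isCompact.isBounded

theorem IsPolytope.hausdorffDist_pos {P Z : Set E} (hP : IsPolytope P) (hZ : IsPolytope Z)
    (hne : P ≠ Z) : 0 < hausdorffDist P Z :=
  lt_of_le_of_ne hausdorffDist_nonneg fun h => hne <|
    (hP.isCompact.isClosed.hausdorffDist_zero_iff_eq hZ.isCompact.isClosed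
      (hP.hausdorffEDist_ne_top hZ)).1 h.symm

theorem IsPolytope.infDist_le_left {P Z : Set E} (hP : IsPolytope P) (hZ : IsPolytope Z) {x : E}
    (hx : x ∈ P) : infDist x Z ≤ hausdorffDist P Z :=
  infDist_le_hausdorffDist_of_mem hx (hP.hausdorffEDist_ne_top hZ)

theorem IsPolytope.infDist_le_right {P Z : Set E} (hP : IsPolytope P) (hZ : IsPolytope Z) {x : E}
    (hx : x ∈ Z) : infDist x P ≤ hausdorffDist P Z := by
  rw [hausdorffDist_comm]
  exact hZ.infDist_le_left hP hx

theorem AchievesHausdorffDist.mem {P Z : Set E} {p q : E} (h : AchievesHausdorffDist P Z p q) :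
    p ∈ P ∧ q ∈ Z := by
  rcases h.2 with ⟨h1, h2⟩ | ⟨h1, h2⟩
  · exact ⟨h1.1, h2.1⟩
  · exact ⟨h2.1, h1.1⟩

theorem AchievesHausdorffDist.inner_sub_le_zero {P Z : Set E} (hP : IsPolytope P)
    (hZ : IsPolytope Z) {p q : E} (h : AchievesHausdorffDist P Z p q) :
    (∀ z ∈ Z, inner ℝ (p - q) (z - q) ≤ 0) ∨ ∀ z ∈ Z, inner ℝ (q - p) (z - q) ≤ 0 := by
  rcases h.2 with ⟨-, h2⟩ | ⟨-, h2⟩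
  · exact Or.inl (h2.inner_sub_le_zero hZ.convex)
  · refine Or.inr (h2.inner_sub_le_zero_of_farthest hP.isCompact hP.convex fun z hz => ?_)
    rw [dist_comm, h.1]
    exact hP.infDist_le_right hZ hz

theorem finite_achievesHausdorffDist {P Z : Set E} (hP : IsPolytope P) (hZ : IsPolytope Z) :
    {pq : E × E | AchievesHausdorffDist P Z pq.1 pq.2}.Finite := by
  have h1 : (⋃ p ∈ P.extremePoints ℝ, {p} ×ˢ {q | IsNearestPoint Z p q}).Finite :=
    hP.finite_extremePoints.biUnion fun p _ => (Set.finite_singleton p).prod <|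
      Set.Subsingleton.finite fun _ ha _ hb => ha.unique hZ.convex hb
  have h2 : (⋃ q ∈ Z.extremePoints ℝ, {p | IsNearestPoint P q p} ×ˢ {q}).Finite :=
    hZ.finite_extremePoints.biUnion fun q _ => Set.Finite.prod
      (Set.Subsingleton.finite fun _ ha _ hb => ha.unique hP.convex hb) (Set.finite_singleton q)
  refine (h1.union h2).subset ?_
  rintro ⟨p, q⟩ ⟨-, ⟨hp, hq⟩ | ⟨hq, hp⟩⟩
  · exact Or.inl (Set.mem_biUnion hp ⟨rfl, hq⟩)
  · exact Or.inr (Set.mem_biUnion hq ⟨hp, rfl⟩)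

/-- Otherwise every vertex of either polytope is strictly closer than the Hausdorff distance to the
other, and the vertex bound makes that distance smaller than itself. -/
theorem exists_achievesHausdorffDist {P Z : Set E} (hP : IsPolytope P) (hZ : IsPolytope Z)
    (hne : P ≠ Z) : {pq : E × E | AchievesHausdorffDist P Z pq.1 pq.2}.Nonempty := by
  by_contra hcon
  have hno : ∀ p q, ¬ AchievesHausdorffDist P Z p q := fun p q h => hcon ⟨(p, q), h⟩
  refine lt_irrefl (hausdorffDist P Z) ?_
  have := hausdorffDist_convexHull_lt hP.finite_extremePoints hZ.finite_extremePoints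
    hP.extremePoints_nonempty hZ.extremePoints_nonempty (hP.hausdorffDist_pos hZ hne) ?_ ?_
  · rwa [hP.convexHull_extremePoints, hZ.convexHull_extremePoints] at this
  · rw [hZ.convexHull_extremePoints]
    refine fun p hp => lt_of_le_of_ne (hP.infDist_le_left hZ hp.1) fun heq => ?_
    obtain ⟨q, hq⟩ := hZ.isCompact.exists_isNearestPoint hZ.nonempty p
    exact hno p q ⟨hq.2.trans heq, Or.inl ⟨hp, hq⟩⟩
  · rw [hP.convexHull_extremePoints]
    refine fun q hq => lt_of_le_of_ne (hP.infDist_le_right hZ hq.1) fun heq => ?_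
    obtain ⟨p, hp⟩ := hP.isCompact.exists_isNearestPoint hP.nonempty q
    exact hno p q ⟨(dist_comm p q).trans (hp.2.trans heq), Or.inr ⟨hq, hp⟩⟩

/-- Moving `q` in a direction at an acute angle with `p - q` brings it closer to `p`. -/
theorem eventually_dist_add_smul_lt {p q w : E} (h : 0 < inner ℝ w (p - q)) :
    ∀ᶠ t : ℝ in 𝓝[>] 0, dist p (q + t • w) < dist p q := by
  -- The squared distance changes by `t * (t * ‖w‖ ^ 2 - 2 * ⟪w, p - q⟫)`, negative for small `t >
  -- 0`.
  have hlim : Tendsto (fun t : ℝ => t * ‖w‖ ^ 2) (𝓝[>] 0) (𝓝 0) :=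
    (Continuous.tendsto' (by fun_prop) 0 0 (by simp)).mono_left nhdsWithin_le_nhds
  filter_upwards [hlim.eventually_lt_const (mul_pos two_pos h), self_mem_nhdsWithin] with t ht ht0
  rw [Set.mem_Ioi] at ht0
  rw [dist_eq_norm, dist_eq_norm, ← sub_sub]
  refine lt_of_pow_lt_pow_left₀ 2 (norm_nonneg _) ?_
  rw [norm_sub_sq_real, inner_smul_right, norm_smul, mul_pow, Real.norm_eq_abs, sq_abs,
    real_inner_comm]
  nlinarith

end Convexity

/-! ### Zonotopes, uniqueness of lifts and the feasibility cone -/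

section Zonotope

variable {d n : ℕ} (Q : Matrix (Fin d) (Fin n) ℝ) (μ : EuclideanSpace ℝ (Fin d))

/-- The vertices of the unit cube. -/
def cubeVertices (n : ℕ) : Set (Fin n → ℝ) := Set.univ.pi fun _ => {0, 1}

theorem finite_cubeVertices : (cubeVertices n).Finite :=
  Set.Finite.pi fun _ => Set.toFinite _

theorem zero_mem_cubeVertices : (0 : Fin n → ℝ) ∈ cubeVertices n := fun _ _ => Or.inl rfl

theorem convexHull_cubeVertices : convexHull ℝ (cubeVertices n) = Set.Icc 0 1 := by
  rw [cubeVertices, convexHull_pi, ← Set.pi_univ_Icc]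
  simp [convexHull_pair, segment_eq_Icc]

theorem cubeVertices_subset : cubeVertices n ⊆ Set.Icc 0 1 :=
  convexHull_cubeVertices (n := n) ▸ subset_convexHull ℝ _

theorem mem_extremePoints_Icc_zero_one {c : ℝ} (hc : c = 0 ∨ c = 1) :
    c ∈ (Set.Icc (0 : ℝ) 1).extremePoints ℝ := by
  rw [mem_extremePoints_iff_left]
  refine ⟨by rcases hc with rfl | rfl <;> simp, ?_⟩
  rintro a ⟨ha0, ha1⟩ b ⟨hb0, hb1⟩ ⟨s, t, hs, ht, hst, hab⟩
  simp only [smul_eq_mul] at hab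
  rcases hc with rfl | rfl
  · nlinarith [mul_nonneg hs.le ha0, mul_nonneg ht.le hb0]
  · nlinarith [mul_nonneg hs.le (sub_nonneg.2 ha1), mul_nonneg ht.le (sub_nonneg.2 hb1)]

theorem cubeVertices_subset_extremePoints :
    cubeVertices n ⊆ (Set.Icc (0 : Fin n → ℝ) 1).extremePoints ℝ := by
  rw [← Set.pi_univ_Icc, extremePoints_pi]
  exact fun x hx i hi => mem_extremePoints_Icc_zero_one (hx i hi)

/-- `zonotopeMap` as an affine map. -/
noncomputable def zonotopeAffineMap : (Fin n → ℝ) →ᵃ[ℝ] EuclideanSpace ℝ (Fin d) :=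
  ((WithLp.linearEquiv 2 ℝ (Fin d → ℝ)).symm.toLinearMap ∘ₗ Q.mulVecLin).toAffineMap +
    AffineMap.const ℝ _ μ

theorem coe_zonotopeAffineMap : ⇑(zonotopeAffineMap Q μ) = zonotopeMap Q μ := rfl

theorem zonotope_eq_convexHull :
    zonotope Q μ = convexHull ℝ (zonotopeMap Q μ '' cubeVertices n) := by
  rw [zonotope, ← convexHull_cubeVertices, ← coe_zonotopeAffineMap, AffineMap.image_convexHull]

theorem isPolytope_zonotope : IsPolytope (zonotope Q μ) := by
  refine ⟨(finite_cubeVertices.image (zonotopeMap Q μ)).toFinset, ?_, ?_⟩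
  · simpa using ⟨0, zero_mem_cubeVertices⟩
  · rw [zonotope_eq_convexHull, Set.Finite.coe_toFinset]

theorem zonotopeMap_sub (x y : Fin n → ℝ) :
    zonotopeMap Q μ x - zonotopeMap Q μ y = WithLp.toLp 2 (Q.mulVec (x - y)) := by
  rw [Matrix.mulVec_sub, WithLp.toLp_sub, zonotopeMap, zonotopeMap, add_sub_add_right_eq_sub]

theorem zonotopeMap_add_smul (ΔQ : Matrix (Fin d) (Fin n) ℝ) (Δμ : EuclideanSpace ℝ (Fin d))
    (t : ℝ) (x : Fin n → ℝ) :
    zonotopeMap (Q + t • ΔQ) (μ + t • Δμ) x = zonotopeMap Q μ x + t • zonotopeMap ΔQ Δμ x := by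
  rw [zonotopeMap, zonotopeMap, zonotopeMap, Matrix.add_mulVec, Matrix.smul_mulVec,
    WithLp.toLp_add, WithLp.toLp_smul, smul_add]
  abel

/-- The lift of a boundary point of a zonotope with generators in general position is unique. -/
theorem zonotopeLift_unique {Q : Matrix (Fin d) (Fin n) ℝ} {μ : EuclideanSpace ℝ (Fin d)}
    (hQ : InGeneralPosition Q) {v q : EuclideanSpace ℝ (Fin d)} (hv : v ≠ 0)
    (hq : ∀ z ∈ zonotope Q μ, inner ℝ v (z - q) ≤ 0) {x y : Fin n → ℝ}
    (hx : x ∈ zonotopeLift Q μ q) (hy : y ∈ zonotopeLift Q μ q) : x = y := by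
  obtain ⟨φ, hφ⟩ : ∃ φ : (Fin d → ℝ) →ₗ[ℝ] ℝ, ∀ a, φ a = inner ℝ v (WithLp.toLp 2 a) :=
    ⟨(innerₛₗ ℝ v) ∘ₗ (WithLp.linearEquiv 2 ℝ (Fin d → ℝ)).symm.toLinearMap, fun _ => rfl⟩
  have hφ0 : φ ≠ 0 := by
    intro h
    have h1 := hφ v.ofLp
    rw [h, LinearMap.zero_apply] at h1
    exact hv (inner_self_eq_zero.1 h1.symm)
  -- Changing one coordinate of a lift stays in the cube and moves `q` along a single generator.
  have hcoord : ∀ u ∈ zonotopeLift Q μ q, ∀ i, ∀ c ∈ Set.Icc (0 : ℝ) 1,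
      (c - u i) * φ (Q.col i) ≤ 0 := by
    rintro u ⟨hu, rfl⟩ i c hc
    have h1 := hq _ ⟨Function.update u i c, ?_, rfl⟩
    · rw [zonotopeMap_sub, ← hφ] at h1
      have h2 : Function.update u i c - u = Pi.single i (c - u i) := by
        ext j
        by_cases hj : j = i
        · subst hj; simp
        · simp [hj]
      rwa [h2, Matrix.mulVec_single, op_smul_eq_smul, map_smul, smul_eq_mul] at h1
    · constructor <;> intro j <;> by_cases hj : j = i
      · subst hj; simpa using hc.1
      · simpa [hj] using hu.1 j
      · subst hj; simpa using hc.2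
      · simpa [hj] using hu.2 j
  have hsupp : ∀ i, x i ≠ y i → φ (Q.col i) = 0 := by
    intro i hi
    by_contra hne
    have mem : ∀ u ∈ zonotopeLift Q μ q, u i ∈ Set.Icc (0 : ℝ) 1 :=
      fun u hu => ⟨hu.1.1 i, hu.1.2 i⟩
    have h1 := hcoord x hx i (y i) (mem y hy)
    have h2 := hcoord y hy i (x i) (mem x hx)
    have h3 : (y i - x i) * φ (Q.col i) = 0 := by linarith
    exact (mul_ne_zero (sub_ne_zero.2 (Ne.symm hi)) hne) h3
  have hsum : ∑ i, (x i - y i) • Q.col i = 0 := by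
    have h1 := zonotopeMap_sub Q μ x y
    rw [hx.2, hy.2, sub_self] at h1
    have h2 : Q.mulVec (x - y) = 0 := (WithLp.toLp_injective 2 h1).symm
    rw [← h2]
    ext j
    simp [Matrix.mulVec, dotProduct, mul_comm]
  let S : Finset (Fin n) := Finset.univ.filter fun i => x i ≠ y i
  -- If the lifts differ in at least `d` coordinates, `d` of those generators span the space and `φ`
  -- vanishes on them; otherwise they are independent and `hsum` forces `x = y`.
  rcases le_total d S.card with hd | hd
  · obtain ⟨T, hTS, hT⟩ := Finset.exists_subset_card_eq hd
    refine absurd ?_ hφ0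
    have hspan := (hQ T hT.le).span_eq_top_of_card_eq_finrank' (by simp [hT])
    refine LinearMap.ext_on_range hspan fun i => ?_
    rw [LinearMap.zero_apply]
    exact hsupp i (Finset.mem_filter.1 (hTS i.2)).2
  · have hS := Fintype.linearIndependent_iff.1 (hQ S hd) (fun i => x i - y i) ?_
    · ext i
      by_contra hi
      exact hi (sub_eq_zero.1 (hS ⟨i, Finset.mem_filter.2 ⟨Finset.mem_univ i, hi⟩⟩))
    · rw [Finset.sum_coe_sort S (fun i => (x i - y i) • Q.col i), ← hsum]
      refine Finset.sum_subset (Finset.subset_univ S) fun i _ hi => ?_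
      have : x i = y i := by
        by_contra h
        exact hi (Finset.mem_filter.2 ⟨Finset.mem_univ i, h⟩)
      rw [this, sub_self, zero_smul]

variable {Q μ} {P : Set (EuclideanSpace ℝ (Fin d))}

theorem AchievesHausdorffDist.ne (hP : IsPolytope P) (hne : P ≠ zonotope Q μ)
    {p q : EuclideanSpace ℝ (Fin d)} (h : AchievesHausdorffDist P (zonotope Q μ) p q) : p ≠ q :=
  dist_pos.1 (h.1 ▸ hP.hausdorffDist_pos (isPolytope_zonotope Q μ) hne)

theorem AchievesHausdorffDist.zonotopeLift_unique (hP : IsPolytope P) (hQ : InGeneralPosition Q)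
    (hne : P ≠ zonotope Q μ) {p q : EuclideanSpace ℝ (Fin d)}
    (h : AchievesHausdorffDist P (zonotope Q μ) p q) {x y : Fin n → ℝ}
    (hx : x ∈ zonotopeLift Q μ q) (hy : y ∈ zonotopeLift Q μ q) : x = y := by
  have hpq := h.ne hP hne
  rcases h.inner_sub_le_zero hP (isPolytope_zonotope Q μ) with hn | hn
  · exact _root_.zonotopeLift_unique hQ (sub_ne_zero.2 hpq) hn hx hy
  · exact _root_.zonotopeLift_unique hQ (sub_ne_zero.2 hpq.symm) hn hx hy

/-- A cube vertex that is the only lift of its image is mapped to a vertex of the zonotope. -/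
theorem zonotopeMap_mem_extremePoints {x : Fin n → ℝ} (hx : x ∈ cubeVertices n)
    (huniq : ∀ y ∈ zonotopeLift Q μ (zonotopeMap Q μ x), y = x) :
    zonotopeMap Q μ x ∈ (zonotope Q μ).extremePoints ℝ := by
  rw [mem_extremePoints_iff_left]
  refine ⟨⟨x, cubeVertices_subset hx, rfl⟩, ?_⟩
  rintro _ ⟨a, ha, rfl⟩ _ ⟨b, hb, rfl⟩ hab
  -- The segment lifts to the cube; its point above the image of `x` is `x` itself, and `x` is
  -- extreme in the cube.
  rw [← coe_zonotopeAffineMap, ← image_openSegment] at hab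
  obtain ⟨c, hc, hcx⟩ := hab
  have hcI : c ∈ Set.Icc (0 : Fin n → ℝ) 1 :=
    (convex_Icc 0 1).openSegment_subset ha hb hc
  obtain rfl := huniq c ⟨hcI, hcx⟩
  rw [(mem_extremePoints_iff_left.1 (cubeVertices_subset_extremePoints hx)).2 a ha b hb hc]

/-- The linear functional defining the inequality of the feasibility cone at a pair `(p, q)` whose
second entry has the lift `e`. -/
noncomputable def feasibilityFunctional (p q : EuclideanSpace ℝ (Fin d)) (e : Fin n → ℝ) :
    Module.Dual ℝ (Matrix (Fin d) (Fin n) ℝ × EuclideanSpace ℝ (Fin d)) where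
  toFun Δ := inner ℝ (zonotopeMap Δ.1 Δ.2 e) (p - q)
  map_add' Δ Δ' := by
    have h := zonotopeMap_add_smul Δ.1 Δ.2 Δ'.1 Δ'.2 1 e
    rw [one_smul, one_smul, one_smul] at h
    rw [Prod.fst_add, Prod.snd_add, h, inner_add_left]
  map_smul' c Δ := by
    have h : zonotopeMap (c • Δ.1) (c • Δ.2) e = c • zonotopeMap Δ.1 Δ.2 e := by
      rw [zonotopeMap, zonotopeMap, Matrix.smul_mulVec, WithLp.toLp_smul, smul_add]
    rw [Prod.smul_fst, Prod.smul_snd, h, real_inner_smul_left]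
    rfl

theorem isPolyhedralCone_feasibilityCone (hP : IsPolytope P) (hQ : InGeneralPosition Q)
    (hne : P ≠ zonotope Q μ) : IsPolyhedralCone (feasibilityCone P Q μ) := by
  have hfin := (finite_achievesHausdorffDist hP (isPolytope_zonotope Q μ)).biUnion fun pq hpq =>
    (Set.Subsingleton.finite fun x hx y hy =>
      AchievesHausdorffDist.zonotopeLift_unique hP hQ hne hpq hx hy :
        (zonotopeLift Q μ pq.2).Finite).image (feasibilityFunctional pq.1 pq.2)
  refine ⟨_, PointedCone.DualFG.dual_of_finite LinearMap.id hfin, ?_⟩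
  ext Δ
  constructor
  · intro h p q hpq e he
    exact h (Set.mem_biUnion (show (p, q) ∈ _ from hpq) ⟨e, he, rfl⟩)
  · intro h f hf
    obtain ⟨pq, hpq, e, he, rfl⟩ := Set.mem_iUnion₂.1 hf
    exact h pq.1 pq.2 hpq e he

/-- Replacing `Δμ` by `Δμ - s (p - q)` stays in the cone for small `s > 0` but lowers the inner
product by `s ‖p - q‖ ^ 2 > 0`, so it cannot vanish. -/
theorem inner_pos_of_mem_interior_feasibilityCone (hP : IsPolytope P) (hne : P ≠ zonotope Q μ)
    {Δ : Matrix (Fin d) (Fin n) ℝ × EuclideanSpace ℝ (Fin d)}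
    (hΔ : Δ ∈ interior (feasibilityCone P Q μ)) {p q : EuclideanSpace ℝ (Fin d)}
    (h : AchievesHausdorffDist P (zonotope Q μ) p q) {e : Fin n → ℝ}
    (he : e ∈ zonotopeLift Q μ q) : 0 < inner ℝ (zonotopeMap Δ.1 Δ.2 e) (p - q) := by
  have hlim : Tendsto (fun s : ℝ => (Δ.1, Δ.2 - s • (p - q))) (𝓝[>] 0) (𝓝 Δ) :=
    (Continuous.tendsto' (by fun_prop) 0 Δ (by simp)).mono_left nhdsWithin_le_nhds
  obtain ⟨s, hs, hs0⟩ :=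
    ((hlim.eventually (mem_interior_iff_mem_nhds.1 hΔ)).and self_mem_nhdsWithin).exists
  have h1 := hs p q h e he
  have h2 : zonotopeMap Δ.1 (Δ.2 - s • (p - q)) e = zonotopeMap Δ.1 Δ.2 e - s • (p - q) := by
    rw [zonotopeMap, zonotopeMap, add_sub_assoc]
  rw [h2, inner_sub_left, real_inner_smul_left] at h1
  have h3 : 0 < inner ℝ (p - q) (p - q) :=
    real_inner_self_pos.2 (sub_ne_zero.2 (h.ne hP hne))
  have h4 := mul_pos (Set.mem_Ioi.1 hs0) h3
  linarith

/-! ### Decrease of the Hausdorff distance under perturbation -/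

theorem eventually_infDist_left_lt (hP : IsPolytope P) (hne : P ≠ zonotope Q μ)
    {Δ : Matrix (Fin d) (Fin n) ℝ × EuclideanSpace ℝ (Fin d)}
    (hΔ : Δ ∈ interior (feasibilityCone P Q μ)) {p : EuclideanSpace ℝ (Fin d)}
    (hp : p ∈ P.extremePoints ℝ) :
    ∀ᶠ t : ℝ in 𝓝[>] 0, infDist p (zonotope (Q + t • Δ.1) (μ + t • Δ.2)) <
      hausdorffDist P (zonotope Q μ) := by
  have hZ := isPolytope_zonotope Q μ
  obtain ⟨q, hq⟩ := hZ.isCompact.exists_isNearestPoint hZ.nonempty p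
  obtain ⟨e, he, heq⟩ := hq.1
  have hdist : ∀ᶠ t : ℝ in 𝓝[>] 0, dist p (q + t • zonotopeMap Δ.1 Δ.2 e) <
      hausdorffDist P (zonotope Q μ) := by
    rcases (hP.infDist_le_left hZ hp.1).lt_or_eq with hlt | heq'
    · refine Tendsto.eventually_lt_const hlt ?_
      rw [← hq.2]
      exact (Continuous.tendsto' (by fun_prop) 0 _ (by simp)).mono_left nhdsWithin_le_nhds
    · have hach : AchievesHausdorffDist P (zonotope Q μ) p q := ⟨hq.2.trans heq', Or.inl ⟨hp, hq⟩⟩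
      rw [← hach.1]
      exact eventually_dist_add_smul_lt
        (inner_pos_of_mem_interior_feasibilityCone hP hne hΔ hach ⟨he, heq⟩)
  filter_upwards [hdist] with t ht
  have hmem : q + t • zonotopeMap Δ.1 Δ.2 e ∈ zonotope (Q + t • Δ.1) (μ + t • Δ.2) :=
    ⟨e, he, by rw [zonotopeMap_add_smul, heq]⟩
  exact (infDist_le_dist_of_mem hmem).trans_lt ht

/-- Cube vertices index generating points of `Z_t` independently of `t`, whereas the vertex set of
`Z_t` may vary. One whose image is farthest from `P` is the unique lift of that image, hence maps to
a vertex of `Z` and yields an achieving pair. -/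
theorem eventually_infDist_right_lt (hP : IsPolytope P) (hQ : InGeneralPosition Q)
    (hne : P ≠ zonotope Q μ) {Δ : Matrix (Fin d) (Fin n) ℝ × EuclideanSpace ℝ (Fin d)}
    (hΔ : Δ ∈ interior (feasibilityCone P Q μ)) {x : Fin n → ℝ} (hx : x ∈ cubeVertices n) :
    ∀ᶠ t : ℝ in 𝓝[>] 0, infDist (zonotopeMap (Q + t • Δ.1) (μ + t • Δ.2) x) P <
      hausdorffDist P (zonotope Q μ) := by
  have hZ := isPolytope_zonotope Q μ
  have hxZ : zonotopeMap Q μ x ∈ zonotope Q μ := ⟨x, cubeVertices_subset hx, rfl⟩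
  obtain ⟨p, hp⟩ := hP.isCompact.exists_isNearestPoint hP.nonempty (zonotopeMap Q μ x)
  simp_rw [zonotopeMap_add_smul]
  rcases (hP.infDist_le_right hZ hxZ).lt_or_eq with hlt | heq
  · refine Tendsto.eventually_lt_const hlt ?_
    have hc : Continuous fun t : ℝ =>
        infDist (zonotopeMap Q μ x + t • zonotopeMap Δ.1 Δ.2 x) P :=
      (continuous_infDist_pt P).comp (by fun_prop)
    exact (hc.tendsto' 0 _ (by simp)).mono_left nhdsWithin_le_nhds
  · have hpq : zonotopeMap Q μ x - p ≠ 0 := by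
      rw [sub_ne_zero, ← dist_pos, hp.2, heq]
      exact hP.hausdorffDist_pos hZ hne
    have hnormal := hp.inner_sub_le_zero_of_farthest (Z := zonotope Q μ) hP.isCompact hP.convex
      fun z hz => by
        rw [hp.2, heq]
        exact hP.infDist_le_right hZ hz
    have hlift : x ∈ zonotopeLift Q μ (zonotopeMap Q μ x) := ⟨cubeVertices_subset hx, rfl⟩
    have hext := zonotopeMap_mem_extremePoints hx fun y hy =>
      zonotopeLift_unique hQ hpq hnormal hy hlift
    have hach : AchievesHausdorffDist P (zonotope Q μ) p (zonotopeMap Q μ x) :=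
      ⟨by rw [dist_comm, hp.2, heq], Or.inr ⟨hext, hp⟩⟩
    filter_upwards [eventually_dist_add_smul_lt
      (inner_pos_of_mem_interior_feasibilityCone hP hne hΔ hach hlift)] with t ht
    rw [← hach.1]
    rw [dist_comm] at ht
    exact (infDist_le_dist_of_mem hp.1).trans_lt ht

theorem eventually_hausdorffDist_lt (hP : IsPolytope P) (hQ : InGeneralPosition Q)
    (hne : P ≠ zonotope Q μ) {Δ : Matrix (Fin d) (Fin n) ℝ × EuclideanSpace ℝ (Fin d)}
    (hΔ : Δ ∈ interior (feasibilityCone P Q μ)) :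
    ∀ᶠ t : ℝ in 𝓝[>] 0, hausdorffDist P (zonotope (Q + t • Δ.1) (μ + t • Δ.2)) <
      hausdorffDist P (zonotope Q μ) := by
  filter_upwards [(hP.finite_extremePoints.eventually_all).2 fun p hp =>
      eventually_infDist_left_lt hP hne hΔ hp,
    (finite_cubeVertices.eventually_all).2 fun x hx =>
      eventually_infDist_right_lt hP hQ hne hΔ hx] with t h1 h2
  have h := hausdorffDist_convexHull_lt hP.finite_extremePoints
    (finite_cubeVertices.image (zonotopeMap (Q + t • Δ.1) (μ + t • Δ.2)))
    hP.extremePoints_nonempty (Set.Nonempty.image _ ⟨0, zero_mem_cubeVertices⟩)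
    (hP.hausdorffDist_pos (isPolytope_zonotope Q μ) hne)
  rw [hP.convexHull_extremePoints, ← zonotope_eq_convexHull] at h
  exact h h1 (Set.forall_mem_image.2 h2)

end Zonotope

theorem mainTheorem2 {d n : ℕ} (P : Set (EuclideanSpace ℝ (Fin d))) (hP : IsPolytope P)
    (Q : Matrix (Fin d) (Fin n) ℝ) (μ : EuclideanSpace ℝ (Fin d))
    (hloc : LocalityConditions P Q μ) (hne : P ≠ zonotope Q μ) :
    {pq : EuclideanSpace ℝ (Fin d) × EuclideanSpace ℝ (Fin d) |
        AchievesHausdorffDist P (zonotope Q μ) pq.1 pq.2}.Finite ∧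
    {pq : EuclideanSpace ℝ (Fin d) × EuclideanSpace ℝ (Fin d) |
        AchievesHausdorffDist P (zonotope Q μ) pq.1 pq.2}.Nonempty ∧
    (∀ p q, AchievesHausdorffDist P (zonotope Q μ) p q → ∃! e, e ∈ zonotopeLift Q μ q) ∧
    IsPolyhedralCone (feasibilityCone P Q μ) ∧
    ∀ Δ ∈ interior (feasibilityCone P Q μ), ∃ ε > 0, ∀ t : ℝ, 0 < t → t < ε →
      Metric.hausdorffDist P (zonotope (Q + t • Δ.1) (μ + t • Δ.2)) <
        Metric.hausdorffDist P (zonotope Q μ) := by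
  have hZ := isPolytope_zonotope Q μ
  have hQ := hloc.generalPosition
  refine ⟨finite_achievesHausdorffDist hP hZ, exists_achievesHausdorffDist hP hZ hne, ?_,
    isPolyhedralCone_feasibilityCone hP hQ hne, ?_⟩
  · intro p q h
    obtain ⟨e, he, heq⟩ := h.mem.2
    exact ⟨e, ⟨he, heq⟩, fun y hy => h.zonotopeLift_unique hP hQ hne hy ⟨he, heq⟩⟩
  · intro Δ hΔ
    obtain ⟨ε, hε, h⟩ := (nhdsGT_basis (0 : ℝ)).eventually_iff.1
      (eventually_hausdorffDist_lt hP hQ hne hΔ)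
    exact ⟨ε, hε, fun t ht0 htε => h ⟨ht0, htε⟩⟩
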